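/- A convex body in $\mathbb{R}^n$ is a nonempty compact convex set; $B_n$ is the closed Euclidean unit ball and $\mathrm V$ is $n$-dimensional Lebesgue measure. For convex bodies $K,E\subset\mathbb{R}^n$ the relative quermassintegrals $\mathrm W_0(K;E),\dots,\mathrm W_n(K;E)$ are the real numbers determined by $\mathrm V(K+\rho E)=\sum_{i=0}^n\binom ni \mathrm W_i(K;E)\rho^i$ for all $\rho\ge 0$; the relative Steiner polynomial is $f(K,E,s)=\sum_{i=0}^n\binom ni \mathrm W_i(K;E)s^i$, $s\in\mathbb{C}$; and, for $E$ with nonempty interior, the relative circumradius $\mathrm R(K;E)$ is the smallest $R\ge 0$ such that $K\subseteq x+RE$ for some $x\in\mathbb{R}^n$. A symmetric lens is the intersection of two distinct closed discs of equal radius $r$ in a plane whose centres are at distance less than $2r$. Theorem. There is a convex body $K\subset\mathbb{R}^3$ with nonempty interior such that every root $s\in\mathbb{C}$ of $f(K,B_3,s)$ satisfies $\operatorname{Re}(s)>-\mathrm R(K;B_3)$. More precisely, there is a symmetric lens $L$ in the plane $\{x_3=0\}\subset\mathbb{R}^3$ with circumradius $\mathrm R(L;B_3)=1$ and perimeter $5.2$,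 and for every $\nu>0$ the body $K=L+\nu B_3$ has these properties. In particular, the conjectured circumradius bound, that some root of $f(K,E,s)$ has real part at most $-\mathrm R(K;E)$, fails for some convex bodies $K,E\subset\mathbb{R}^3$ with nonempty interior. -/

import Mathlib

open MeasureTheory Polynomial
open scoped Pointwise

noncomputable section

/-- `n`-dimensional Euclidean space. -/
abbrev Euc (n : ℕ) : Type := EuclideanSpace ℝ (Fin n)

/-- The unit ball `B_n`, as a convex body. -/
def unitBall (n : ℕ) : ConvexBody (Euc n) where
  carrier := Metric.closedBall 0 1
  convex' := convex_closedBall 0 1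
  isCompact' := isCompact_closedBall 0 1
  nonempty' := ⟨0, by simp⟩

/-- The numbers `W_0, …, W_n` satisfy the relative Steiner formula
`V(K + ρ E) = ∑ i, (n choose i) W_i ρ ^ i` for all `ρ ≥ 0`. -/
def SteinerFormula {n : ℕ} (K E : ConvexBody (Euc n)) (W : Fin (n + 1) → ℝ) : Prop :=
  ∀ ρ : ℝ, 0 ≤ ρ →
    volume.real (K + ρ • E : Set (Euc n)) = ∑ i : Fin (n + 1), (n.choose i : ℝ) * W i * ρ ^ (i : ℕ)

/-- The relative quermassintegrals `W_i(K;E)`: the numbers determined by the relative Steiner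
formula. -/
def quermassintegral {n : ℕ} (K E : ConvexBody (Euc n)) : Fin (n + 1) → ℝ :=
  Classical.epsilon (SteinerFormula K E)

/-- There is at most one family of numbers that satisfies the Steiner formula. -/
theorem SteinerFormula.unique {n : ℕ} {K E : ConvexBody (Euc n)} {W W' : Fin (n + 1) → ℝ}
    (h : SteinerFormula K E W) (h' : SteinerFormula K E W') : W = W' := by
  set P : (Fin (n + 1) → ℝ) → ℝ[X] := fun W =>
    ∑ i : Fin (n + 1), C ((n.choose i : ℝ) * W i) * X ^ (i : ℕ) with hP
  have heq : P W = P W' := by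
    refine Polynomial.eq_of_infinite_eval_eq _ _ ((Set.Ici_infinite (0 : ℝ)).mono ?_)
    intro ρ hρ
    have h1 := (h ρ hρ).symm.trans (h' ρ hρ)
    simpa [hP, Polynomial.eval_finsetSum] using h1
  funext j
  have hc : ∀ V : Fin (n + 1) → ℝ, (P V).coeff (j : ℕ) = (n.choose j : ℝ) * V j := by
    intro V
    simp only [hP, Polynomial.finsetSum_coeff, Polynomial.coeff_C_mul_X_pow]
    rw [Finset.sum_eq_single j]
    · simp
    · intro b _ hb
      exact if_neg fun hh => hb (Fin.ext hh.symm)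
    · simp
  have h2 := congrArg (fun p : ℝ[X] => p.coeff (j : ℕ)) heq
  simp only [hc] at h2
  have hne : (n.choose j : ℝ) ≠ 0 := by
    exact_mod_cast (Nat.choose_pos (Nat.lt_succ_iff.mp j.isLt)).ne'
  exact mul_left_cancel₀ hne h2

/-- Numbers that satisfy the Steiner formula are the quermassintegrals. -/
theorem SteinerFormula.quermassintegral_eq {n : ℕ} {K E : ConvexBody (Euc n)}
    {W : Fin (n + 1) → ℝ} (h : SteinerFormula K E W) : quermassintegral K E = W :=
  SteinerFormula.unique (Classical.epsilon_spec ⟨W, h⟩) h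

/-- The relative Steiner polynomial `f(K, E, s) = ∑ i, (n choose i) W_i(K;E) s ^ i` in a complex
variable `s`. -/
def steinerPolynomial {n : ℕ} (K E : ConvexBody (Euc n)) : ℂ[X] :=
  ∑ i : Fin (n + 1), C ((n.choose i : ℂ) * (quermassintegral K E i : ℂ)) * X ^ (i : ℕ)

/-- The relative circumradius `R(K;E)`: the least `R ≥ 0` such that some translate of `R E`
contains `K`. -/
def circumradius {n : ℕ} (K E : ConvexBody (Euc n)) : ℝ :=
  sInf {R : ℝ | 0 ≤ R ∧ ∃ x : Euc n, (K : Set (Euc n)) ⊆ x +ᵥ (R • (E : Set (Euc n)))}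

/-- The conjectured circumradius bound for `K` and `E`: the smallest real part of the roots
of `f(K, E, s)` is at most `-R(K;E)`, that is, some root has real part at most `-R(K;E)`. -/
def CircumradiusBound {n : ℕ} (K E : ConvexBody (Euc n)) : Prop :=
  ∃ s : ℂ, (steinerPolynomial K E).IsRoot s ∧ s.re ≤ -circumradius K E

/-- A planar symmetric lens in `ℝ³`: the intersection of two distinct overlapping discs of the
same radius in the plane `x₃ = 0`. -/
def IsSymmetricLens (L : ConvexBody (Euc 3)) : Prop :=
  ∃ (a b : Euc 3) (r : ℝ), a 2 = 0 ∧ b 2 = 0 ∧ 0 < dist a b ∧ dist a b < 2 * r ∧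
    (L : Set (Euc 3)) = {x | x 2 = 0 ∧ dist x a ≤ r ∧ dist x b ≤ r}

/-- The perimeter of a two-dimensional convex body in `ℝ³`: the length (one-dimensional Hausdorff
measure) of its boundary relative to the plane that it spans. -/
def perimeter (L : ConvexBody (Euc 3)) : ℝ :=
  (Measure.hausdorffMeasure 1 (intrinsicFrontier ℝ (L : Set (Euc 3)))).toReal

end

/-! For a planar body `L` of area `A` and perimeter `p`, slicing `L + ρ B_3` at height `z` gives the
planar parallel region of `L` at distance `√(ρ² - z²)`. Integrating the planar Steiner polynomial `A
+ p t + π t²` over these slices gives the volume `2 A ρ + (π/2) p ρ² + (4π/3) ρ³`. The Steiner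
polynomial of `L` therefore has the root `0` and two further roots. If those are not real, both have
real part `-3p/16`, which exceeds `-1` when `p < 16/3`. They are non-real exactly when `A >
3πp²/128`.

So a body of circumradius `1` is needed whose perimeter is below `16/3` but whose area is large for
that perimeter. The symmetric lens with tips `(±1, 0)` does this. If its arcs have radius `r` and
half-angle `θ`, then `r sin θ = 1`, the centres are `(0, ±h)` with `h = r cos θ`, `p = 4rθ` and `A =
2r²θ - 2h`. For `p = 5.2` the real part is `-0.975` and the area threshold is about `1.99098`;
`lens_area_bound` gives `A > 1.9915`.

Passing to `L + ν B_3` replaces `s` by `s + ν` in the polynomial and adds `ν` to the circumradius,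
so the strict inequality persists while the body acquires interior points.

The Steiner formula is proved by explicit integration: `nearLens_iff` describes the planar parallel
regions, `volume_nearLens` gives their area and `volume_parallel_lens` integrates over slices. The
perimeter, a Hausdorff measure, comes from `hausdorffMeasure_real_arc` and
`intrinsicFrontier_lensBody`. -/

noncomputable section

/-! ### Parallel regions of the lens in the plane -/

/-- The triangle inequality in the plane, in coordinates. -/
theorem planar_triangle {u v w z r t : ℝ} (hr : 0 ≤ r) (ht : 0 ≤ t)
    (h₁ : u ^ 2 + v ^ 2 ≤ r ^ 2) (h₂ : w ^ 2 + z ^ 2 ≤ t ^ 2) :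
    (u + w) ^ 2 + (v + z) ^ 2 ≤ (r + t) ^ 2 := by
  have h : u * w + v * z ≤ r * t := by
    apply le_of_sq_le_sq _ (by positivity)
    have : (u ^ 2 + v ^ 2) * (w ^ 2 + z ^ 2) ≤ r ^ 2 * t ^ 2 :=
      mul_le_mul h₁ h₂ (by positivity) (by positivity)
    nlinarith [sq_nonneg (u * z - v * w)]
  nlinarith

/-- The point `(x, y)` has distance at most `t` from the planar lens with tips `(±1, 0)` that is
cut out by the discs of radius `r` about `(0, ±h)`. -/
def NearLens (h r t x y : ℝ) : Prop :=
  ∃ a b : ℝ, a ^ 2 + (b + h) ^ 2 ≤ r ^ 2 ∧ a ^ 2 + (b - h) ^ 2 ≤ r ^ 2 ∧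
    (x - a) ^ 2 + (y - b) ^ 2 ≤ t ^ 2

theorem nearLens_neg_left {h r t x y : ℝ} : NearLens h r t (-x) y ↔ NearLens h r t x y := by
  constructor <;>
  · rintro ⟨a, b, h₁, h₂, h₃⟩
    exact ⟨-a, b, by linarith [neg_sq a], by linarith [neg_sq a], by nlinarith⟩

theorem nearLens_neg_right {h r t x y : ℝ} : NearLens h r t x (-y) ↔ NearLens h r t x y := by
  constructor <;>
  · rintro ⟨a, b, h₁, h₂, h₃⟩
    exact ⟨a, -b, by nlinarith, by nlinarith, by nlinarith⟩

theorem nearLens_abs {h r t x y : ℝ} : NearLens h r t |x| |y| ↔ NearLens h r t x y := by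
  rcases abs_choice x with hx | hx <;> rcases abs_choice y with hy | hy <;>
    simp only [hx, hy, nearLens_neg_left, nearLens_neg_right]

theorem nearLens_tip {h r t x y : ℝ} (hr2 : r ^ 2 = 1 + h ^ 2) (H : (x - 1) ^ 2 + y ^ 2 ≤ t ^ 2) :
    NearLens h r t x y :=
  ⟨1, 0, by nlinarith, by nlinarith, by nlinarith⟩

theorem NearLens.mem_disc {h r t x y : ℝ} (hr : 0 < r) (ht : 0 ≤ t) (H : NearLens h r t x y) :
    x ^ 2 + (y + h) ^ 2 ≤ (r + t) ^ 2 := by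
  obtain ⟨a, b, h₁, -, h₃⟩ := H
  have := planar_triangle hr.le ht h₁ h₃
  convert this using 2 <;> ring

/-- Near the circular arc, the parallel region of the lens is bounded by a concentric arc. -/
theorem nearLens_iff_of_le {h r t x y : ℝ} (hh : 0 < h) (hr : 0 < r) (hr2 : r ^ 2 = 1 + h ^ 2)
    (ht : 0 ≤ t) (hx : 0 ≤ x) (hy : 0 ≤ y) (hxt : x ≤ 1 + t / r) :
    NearLens h r t x y ↔ x ^ 2 + (y + h) ^ 2 ≤ (r + t) ^ 2 := by
  refine ⟨NearLens.mem_disc hr ht, fun H => ?_⟩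
  by_cases h1 : x ^ 2 + (y + h) ^ 2 ≤ r ^ 2
  · exact ⟨x, y, h1, by nlinarith, by nlinarith⟩
  push Not at h1
  -- The line `y + h = h x` runs from the centre `(0, -h)` through the tip `(1, 0)`. Above it the
  -- nearest point of the lens is the radial projection to the arc; below it, the tip.
  by_cases h2 : x * h ≤ y + h
  · set d := √(x ^ 2 + (y + h) ^ 2) with hd
    have hd2 : d ^ 2 = x ^ 2 + (y + h) ^ 2 := Real.sq_sqrt (by positivity)
    have hrd : r < d := Real.lt_sqrt_of_sq_lt h1
    have hd0 : 0 < d := hr.trans hrd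
    have hdR : d ≤ r + t := by
      apply le_of_sq_le_sq _ (by positivity)
      rw [hd2]; exact H
    have hb : h ≤ r * (y + h) / d := by
      rw [le_div_iff₀ hd0]
      apply le_of_sq_le_sq _ (by positivity)
      have : (x * h) ^ 2 ≤ (y + h) ^ 2 := pow_le_pow_left₀ (by positivity) h2 2
      rw [mul_pow, mul_pow, hd2, hr2]
      nlinarith
    have e1 : (r * x / d) ^ 2 + (r * (y + h) / d) ^ 2 = r ^ 2 := by
      field_simp
      rw [hd2]
    refine ⟨r * x / d, r * (y + h) / d - h, ?_, ?_, ?_⟩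
    · rw [sub_add_cancel, e1]
    · nlinarith
    · have e2 : (x - r * x / d) ^ 2 + (y - (r * (y + h) / d - h)) ^ 2 = (d - r) ^ 2 := by
        have : (x - r * x / d) ^ 2 + (y - (r * (y + h) / d - h)) ^ 2
          = (1 - r / d) ^ 2 * (x ^ 2 + (y + h) ^ 2) := by ring
        rw [this, ← hd2]
        field_simp
      rw [e2]
      exact pow_le_pow_left₀ (by linarith) (by linarith) 2
  · push Not at h2
    have h3 : y < h * (x - 1) := by linarith
    have h4 : 0 < x - 1 := by
      by_contra hc
      nlinarith
    have h5 : (x - 1) * r ≤ t := by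
      rw [← le_div_iff₀ hr]; linarith
    apply nearLens_tip hr2
    have : y ^ 2 ≤ (h * (x - 1)) ^ 2 := pow_le_pow_left₀ hy h3.le 2
    have h6 : ((x - 1) * r) ^ 2 ≤ t ^ 2 := pow_le_pow_left₀ (by positivity) h5 2
    rw [mul_pow, hr2] at h6
    nlinarith

/-- Near the tip, the parallel region of the lens is bounded by a circle about the tip. -/
theorem nearLens_iff_of_lt {h r t x y : ℝ} (hh : 0 < h) (hr : 0 < r) (hr2 : r ^ 2 = 1 + h ^ 2)
    (ht : 0 ≤ t) (hy : 0 ≤ y) (hxt : 1 + t / r < x) :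
    NearLens h r t x y ↔ (x - 1) ^ 2 + y ^ 2 ≤ t ^ 2 := by
  refine ⟨fun H => ?_, nearLens_tip hr2⟩
  have htr : 0 ≤ t / r := by positivity
  have hx1 : 0 < x - 1 := by linarith
  -- Above that line, `x² + (y + h)²` would exceed `x² r²`, hence `(r + t)²`, so the point would lie
  -- outside the enlarged disc.
  have hy1 : y ≤ h * (x - 1) := by
    by_contra hc
    push Not at hc
    have h1 := H.mem_disc hr ht
    have h2 : (h * x) ^ 2 ≤ (y + h) ^ 2 := pow_le_pow_left₀ (by nlinarith) (by linarith) 2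
    have h3 : r + t < x * r := by
      have : r + t = (1 + t / r) * r := by field_simp
      rw [this]
      exact mul_lt_mul_of_pos_right hxt hr
    have h4 : (r + t) ^ 2 < (x * r) ^ 2 := pow_lt_pow_left₀ h3 (by positivity) (by norm_num)
    rw [mul_pow x, hr2] at h4
    nlinarith
  obtain ⟨a, b, h₁, h₂, h₃⟩ := H
  have ha : a ≤ 1 := by
    by_contra hc
    push Not at hc
    nlinarith [sq_nonneg b]
  -- The lens lies on one side of the tangent at the tip to the disc about `(0, -h)`. This makes the
  -- angle at the tip in `key` non-acute, so the tip is at least as close as `(a, b)`.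
  have hab : a - 1 + h * b ≤ 0 := by nlinarith [sq_nonneg (a - 1), sq_nonneg b]
  have key : (x - 1) * (a - 1) + y * b ≤ 0 := by
    rcases le_or_gt b 0 with hb | hb
    · nlinarith
    · nlinarith [mul_le_mul_of_nonneg_right hy1 hb.le]
  nlinarith [sq_nonneg (a - 1), sq_nonneg b]

/-- The height at `x` of the upper boundary of the parallel region at distance `t` of the lens. -/
def lensProfile (h r t x : ℝ) : ℝ :=
  if |x| ≤ 1 + t / r then √((r + t) ^ 2 - x ^ 2) - h else √(t ^ 2 - (|x| - 1) ^ 2)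

/-- Since `r + t = (1 + t/r) r`, the right side is at least `(1 + t/r)² (r² - 1) = (1 + t/r)² h²`.
Hence the arc part of `lensProfile` never drops below the axis. -/
theorem sq_le_of_abs_le_one_add_div {h r t x : ℝ} (hr : 0 < r)
    (hr2 : r ^ 2 = 1 + h ^ 2) (ht : 0 ≤ t) (hx : |x| ≤ 1 + t / r) :
    h ^ 2 ≤ (r + t) ^ 2 - x ^ 2 := by
  have h1 : |x| * r ≤ r + t := by
    have : r + t = (1 + t / r) * r := by field_simp
    rw [this]; exact mul_le_mul_of_nonneg_right hx hr.le
  have h2 : (|x| * r) ^ 2 ≤ (r + t) ^ 2 := pow_le_pow_left₀ (by positivity) h1 2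
  have h3 : |x| ^ 2 ≤ (1 + t / r) ^ 2 := pow_le_pow_left₀ (by positivity) hx 2
  rw [mul_pow, hr2] at h2
  rw [sq_abs] at h2 h3
  have h4 : (r + t) ^ 2 = (1 + t / r) ^ 2 * (1 + h ^ 2) := by
    rw [← hr2]; field_simp
  have h5 : 1 ≤ (1 + t / r) ^ 2 := one_le_pow₀ (by linarith [div_nonneg ht hr.le])
  nlinarith [sq_nonneg h]

theorem lensProfile_nonneg {h r t x : ℝ} (hr : 0 < r) (hr2 : r ^ 2 = 1 + h ^ 2)
    (ht : 0 ≤ t) : 0 ≤ lensProfile h r t x := by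
  unfold lensProfile
  split_ifs with hx
  · have := Real.le_sqrt_of_sq_le (sq_le_of_abs_le_one_add_div hr hr2 ht hx)
    linarith
  · positivity

/-- The boundary pieces meet where the ray from a disc centre through a tip leaves the parallel
region, at distance `t` beyond the tip. The ray has direction `(1, h)/r`, whence the abscissa `1 +
t/r`. -/
theorem nearLens_iff {h r t x y : ℝ} (hh : 0 < h) (hr : 0 < r) (hr2 : r ^ 2 = 1 + h ^ 2)
    (ht : 0 ≤ t) :
    NearLens h r t x y ↔ |x| ≤ 1 + t ∧ |y| ≤ lensProfile h r t x := by
  have hr1 : 1 ≤ r := by nlinarith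
  have htr : t / r ≤ t := div_le_self ht hr1
  rw [← nearLens_abs]
  unfold lensProfile
  split_ifs with hx
  · rw [nearLens_iff_of_le hh hr hr2 ht (abs_nonneg x) (abs_nonneg y) hx, le_sub_iff_add_le,
      Real.le_sqrt (by positivity)
        (le_trans (sq_nonneg h) (sq_le_of_abs_le_one_add_div hr hr2 ht hx)), sq_abs x]
    constructor
    · intro H; exact ⟨by linarith, by linarith⟩
    · rintro ⟨-, H⟩; linarith
  · push Not at hx
    rw [nearLens_iff_of_lt hh hr hr2 ht (abs_nonneg y) hx]
    have h0 : 0 ≤ |x| - 1 := by linarith [div_nonneg ht hr.le]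
    constructor
    · intro H
      refine ⟨?_, Real.le_sqrt_of_sq_le (by linarith)⟩
      have : |x| - 1 ≤ t := le_of_sq_le_sq (by nlinarith [sq_nonneg |y|]) ht
      linarith
    · rintro ⟨H1, H2⟩
      have h3 : (|x| - 1) ^ 2 ≤ t ^ 2 := pow_le_pow_left₀ h0 (by linarith) 2
      rw [Real.le_sqrt (abs_nonneg y) (by linarith)] at H2
      linarith

/-! ### Area of the planar parallel regions -/

theorem integral_sqrt_sq_sub_sq {R α β : ℝ} (hR : 0 ≤ R) (hα : -(Real.pi / 2) ≤ α) (hαβ : α ≤ β)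
    (hβ : β ≤ Real.pi / 2) :
    ∫ x in R * Real.sin α..R * Real.sin β, √(R ^ 2 - x ^ 2) =
      R ^ 2 / 2 * (β - α + Real.cos β * Real.sin β - Real.cos α * Real.sin α) := by
  have h := intervalIntegral.integral_comp_mul_deriv'' (a := α) (b := β)
    (f := fun φ => R * Real.sin φ) (f' := fun φ => R * Real.cos φ)
    (g := fun x => √(R ^ 2 - x ^ 2)) (by fun_prop)
    (fun x _ => ((Real.hasDerivAt_sin x).const_mul R).hasDerivWithinAt) (by fun_prop)
    (by fun_prop)
  rw [← h]
  have h2 : ∀ φ ∈ Set.uIcc α β, ((fun x => √(R ^ 2 - x ^ 2)) ∘ fun φ => R * Real.sin φ) φ *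
      (R * Real.cos φ) = R ^ 2 * Real.cos φ ^ 2 := by
    intro φ hφ
    rw [Set.uIcc_of_le hαβ] at hφ
    have hc : 0 ≤ Real.cos φ :=
      Real.cos_nonneg_of_neg_pi_div_two_le_of_le (hα.trans hφ.1) (hφ.2.trans hβ)
    have : R ^ 2 - (R * Real.sin φ) ^ 2 = (R * Real.cos φ) ^ 2 := by
      nlinarith [Real.sin_sq_add_cos_sq φ]
    simp only [Function.comp]
    rw [this, Real.sqrt_sq (by positivity)]
    ring
  rw [intervalIntegral.integral_congr h2, intervalIntegral.integral_const_mul, integral_cos_sq]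
  ring

theorem measurable_lensProfile (h r t : ℝ) : Measurable (lensProfile h r t) := by
  unfold lensProfile
  exact Measurable.ite (measurableSet_le (by fun_prop) (by fun_prop)) (by fun_prop) (by fun_prop)

theorem lensProfile_neg (h r t x : ℝ) : lensProfile h r t (-x) = lensProfile h r t x := by
  simp [lensProfile]

theorem lensProfile_le {h r t x : ℝ} (hh : 0 < h) (hr : 0 < r) (ht : 0 ≤ t) :
    lensProfile h r t x ≤ r + t := by
  unfold lensProfile
  split_ifs with hx
  · have : √((r + t) ^ 2 - x ^ 2) ≤ r + t :=
      Real.sqrt_le_left (by positivity) |>.mpr (by nlinarith [sq_nonneg x])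
    linarith
  · have : √(t ^ 2 - (|x| - 1) ^ 2) ≤ t :=
      Real.sqrt_le_left ht |>.mpr (by nlinarith [sq_nonneg (|x| - 1)])
    linarith

theorem intervalIntegrable_lensProfile {h r t : ℝ} (hh : 0 < h) (hr : 0 < r)
    (hr2 : r ^ 2 = 1 + h ^ 2) (ht : 0 ≤ t) (a b : ℝ) :
    IntervalIntegrable (lensProfile h r t) volume a b := by
  rw [intervalIntegrable_iff]
  refine Measure.integrableOn_of_bounded (M := r + t) (by simp)
    (measurable_lensProfile h r t).aestronglyMeasurable (Filter.Eventually.of_forall fun x => ?_)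
  rw [Real.norm_of_nonneg (lensProfile_nonneg hr hr2 ht)]
  exact lensProfile_le hh hr ht

/-- The breakpoints are sines on both circles: `1 + t/r = (r + t) sin θ` for the enlarged arc, and
`t/r = t sin θ` for the circle about the tip. Each piece is thus an instance of
`integral_sqrt_sq_sub_sq`. -/
theorem integral_lensProfile {θ h r t : ℝ} (hh : 0 < h) (hr : 0 < r) (hr2 : r ^ 2 = 1 + h ^ 2)
    (hθ0 : 0 ≤ θ) (hθ : θ ≤ Real.pi / 2) (hs : r * Real.sin θ = 1) (hc : r * Real.cos θ = h)
    (ht : 0 ≤ t) :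
    ∫ x in -(1 + t)..(1 + t), lensProfile h r t x =
      (2 * r ^ 2 * θ - 2 * h + 4 * r * θ * t + Real.pi * t ^ 2) / 2 := by
  have hr1 : 1 ≤ r := by nlinarith
  have htr : t / r ≤ t := div_le_self ht hr1
  have htr0 : 0 ≤ t / r := by positivity
  have hs' : Real.sin θ = 1 / r := by field_simp; linarith
  have hc' : Real.cos θ = h / r := by field_simp; linarith
  have hside : ∫ x in (1 + t / r)..(1 + t), lensProfile h r t x =
      t ^ 2 / 2 * (Real.pi / 2 - θ - h / r ^ 2) := by
    have h1 : ∫ x in (1 + t / r)..(1 + t), lensProfile h r t x =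
        ∫ x in (1 + t / r)..(1 + t), √(t ^ 2 - (x - 1) ^ 2) := by
      refine intervalIntegral.integral_congr_ae (Filter.Eventually.of_forall fun x hx => ?_)
      rw [Set.uIoc_of_le (by linarith)] at hx
      have hx0 : |x| = x := abs_of_pos (by linarith [hx.1])
      rw [lensProfile, hx0, if_neg (not_le.mpr hx.1)]
    rw [h1, intervalIntegral.integral_comp_sub_right (fun x => √(t ^ 2 - x ^ 2)) 1]
    have h2 := integral_sqrt_sq_sub_sq (R := t) ht (by linarith [Real.pi_pos]) hθ le_rfl
    rw [Real.sin_pi_div_two, Real.cos_pi_div_two, hs', hc'] at h2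
    rw [show 1 + t / r - 1 = t * (1 / r) by ring, show 1 + t - 1 = t * 1 by ring, h2]
    field_simp
    ring
  have hside' : ∫ x in -(1 + t)..-(1 + t / r), lensProfile h r t x =
      t ^ 2 / 2 * (Real.pi / 2 - θ - h / r ^ 2) := by
    rw [← hside, ← intervalIntegral.integral_comp_neg]
    simp only [lensProfile_neg]
  have hmid : ∫ x in -(1 + t / r)..(1 + t / r), lensProfile h r t x =
      (r + t) ^ 2 * (θ + h / r ^ 2) - 2 * h * (1 + t / r) := by
    have h1 : ∫ x in -(1 + t / r)..(1 + t / r), lensProfile h r t x =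
        ∫ x in -(1 + t / r)..(1 + t / r), (√((r + t) ^ 2 - x ^ 2) - h) := by
      refine intervalIntegral.integral_congr fun x hx => ?_
      rw [Set.uIcc_of_le (by linarith)] at hx
      simp only [lensProfile]
      rw [if_pos (abs_le.mpr hx)]
    have h2 := integral_sqrt_sq_sub_sq (R := r + t) (α := -θ) (β := θ) (by positivity)
      (by linarith) (by linarith) hθ
    rw [Real.sin_neg, Real.cos_neg, hs', hc'] at h2
    rw [h1, intervalIntegral.integral_sub (Continuous.intervalIntegrable (by fun_prop) _ _)
      (by simp), intervalIntegral.integral_const,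
      show -(1 + t / r) = (r + t) * -(1 / r) by field_simp,
      show (1 + t / r) = (r + t) * (1 / r) by field_simp, h2, smul_eq_mul]
    field_simp
    ring
  have hint := intervalIntegrable_lensProfile hh hr hr2 ht
  rw [← intervalIntegral.integral_add_adjacent_intervals (hint _ (1 + t / r)) (hint _ _),
    ← intervalIntegral.integral_add_adjacent_intervals (hint _ (-(1 + t / r))) (hint _ _),
    hside, hside', hmid]
  field_simp
  ring

theorem measurableSet_nearLens {h r t : ℝ} (hh : 0 < h) (hr : 0 < r) (hr2 : r ^ 2 = 1 + h ^ 2)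
    (ht : 0 ≤ t) : MeasurableSet {p : ℝ × ℝ | NearLens h r t p.1 p.2} := by
  simp only [nearLens_iff hh hr hr2 ht]
  have := measurable_lensProfile h r t
  have h1 : MeasurableSet {p : ℝ × ℝ | |p.1| ≤ 1 + t} :=
    measurableSet_le (by fun_prop) (by fun_prop)
  have h2 : MeasurableSet {p : ℝ × ℝ | |p.2| ≤ lensProfile h r t p.1} :=
    measurableSet_le (by fun_prop) (by fun_prop)
  exact h1.inter h2

/-- The planar Steiner formula for the lens. -/
theorem volume_nearLens {θ h r t : ℝ} (hh : 0 < h) (hr : 0 < r) (hr2 : r ^ 2 = 1 + h ^ 2)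
    (hθ0 : 0 ≤ θ) (hθ : θ ≤ Real.pi / 2) (hs : r * Real.sin θ = 1) (hc : r * Real.cos θ = h)
    (ht : 0 ≤ t) :
    volume {p : ℝ × ℝ | NearLens h r t p.1 p.2} =
      ENNReal.ofReal (2 * r ^ 2 * θ - 2 * h + 4 * r * θ * t + Real.pi * t ^ 2) := by
  rw [Measure.volume_eq_prod, Measure.prod_apply (measurableSet_nearLens hh hr hr2 ht)]
  -- The closed interval is written as a half-open one plus a null point, to match the convention of
  -- interval integrals.
  have h1 : ∀ x, volume (Prod.mk x ⁻¹' {p : ℝ × ℝ | NearLens h r t p.1 p.2}) =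
      (Set.Ioc (-(1 + t)) (1 + t) ∪ {-(1 + t)}).indicator
        (fun x => ENNReal.ofReal (2 * lensProfile h r t x)) x := by
    intro x
    have hset : Prod.mk x ⁻¹' {p : ℝ × ℝ | NearLens h r t p.1 p.2} =
        {y | |x| ≤ 1 + t ∧ |y| ≤ lensProfile h r t x} := by
      ext y
      exact nearLens_iff hh hr hr2 ht
    rw [hset]
    by_cases hx : |x| ≤ 1 + t
    · rw [Set.indicator_of_mem]
      · have : {y | |x| ≤ 1 + t ∧ |y| ≤ lensProfile h r t x} =
            Set.Icc (-lensProfile h r t x) (lensProfile h r t x) := by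
          ext y
          simp [hx, abs_le]
        rw [this, Real.volume_Icc]
        congr 1
        ring
      · have := abs_le.mp hx
        rcases this.1.lt_or_eq with h | h
        · exact Or.inl ⟨h, this.2⟩
        · exact Or.inr h.symm
    · rw [Set.indicator_of_notMem]
      · simp [hx]
      · rintro (h | h)
        · exact hx (abs_le.mpr ⟨h.1.le, h.2⟩)
        · apply hx
          rw [Set.mem_singleton_iff.mp h, abs_neg, abs_of_nonneg (by linarith)]
  simp only [h1]
  rw [lintegral_indicator (measurableSet_Ioc.union (measurableSet_singleton _))]
  have h2 : volume.restrict (Set.Ioc (-(1 + t)) (1 + t) ∪ {-(1 + t)}) =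
      volume.restrict (Set.Ioc (-(1 + t)) (1 + t)) := by
    apply Measure.restrict_congr_set
    exact union_ae_eq_left_of_ae_eq_empty (by simp [ae_eq_empty])
  rw [h2, ← ofReal_integral_eq_lintegral_ofReal]
  · rw [integral_const_mul, ← intervalIntegral.integral_of_le (by linarith),
      integral_lensProfile hh hr hr2 hθ0 hθ hs hc ht]
    congr 1
    ring
  · refine Integrable.const_mul ?_ 2
    have := intervalIntegrable_lensProfile hh hr hr2 ht (-(1 + t)) (1 + t)
    rwa [intervalIntegrable_iff, Set.uIoc_of_le (by linarith)] at this
  · exact Filter.Eventually.of_forall fun x =>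
      mul_nonneg zero_le_two (lensProfile_nonneg hr hr2 ht)

/-- Needed to pass between `ENNReal.ofReal` and the real integral over the slices. -/
theorem planar_steiner_nonneg {θ h r t : ℝ} (hh : 0 < h) (hr : 0 < r) (hr2 : r ^ 2 = 1 + h ^ 2)
    (hθ0 : 0 ≤ θ) (hθ : θ ≤ Real.pi / 2) (hs : r * Real.sin θ = 1) (hc : r * Real.cos θ = h)
    (ht : 0 ≤ t) :
    0 ≤ 2 * r ^ 2 * θ - 2 * h + 4 * r * θ * t + Real.pi * t ^ 2 := by
  have h1 := integral_lensProfile hh hr hr2 hθ0 hθ hs hc ht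
  have h2 : 0 ≤ ∫ x in -(1 + t)..(1 + t), lensProfile h r t x :=
    intervalIntegral.integral_nonneg (by linarith) fun x _ => lensProfile_nonneg hr hr2 ht
  linarith

/-! ### Volume of the parallel bodies by horizontal slices -/

/-- Coordinates of `ℝ³`, the last one first. -/
def lastFirst : Euc 3 ≃ᵐ ℝ × (ℝ × ℝ) :=
  ((MeasurableEquiv.toLp 2 (Fin 3 → ℝ)).symm.trans
    (MeasurableEquiv.piFinSuccAbove (fun _ : Fin 3 => ℝ) 2)).trans
    ((MeasurableEquiv.refl ℝ).prodCongr MeasurableEquiv.finTwoArrow)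

theorem measurePreserving_lastFirst : MeasurePreserving lastFirst volume volume :=
  ((EuclideanSpace.volume_preserving_symm_measurableEquiv_toLp (Fin 3)).trans
    (volume_preserving_piFinSuccAbove (fun _ : Fin 3 => ℝ) 2)).trans
    ((MeasurePreserving.id volume).prod (volume_preserving_finTwoArrow ℝ))

theorem integral_sqrt_sq_sub_sq_full {ρ : ℝ} (hρ : 0 ≤ ρ) :
    ∫ z in -ρ..ρ, √(ρ ^ 2 - z ^ 2) = Real.pi * ρ ^ 2 / 2 := by
  have h := integral_sqrt_sq_sub_sq hρ (le_refl (-(Real.pi / 2))) (by linarith [Real.pi_pos])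
    (le_refl (Real.pi / 2))
  simp only [Real.sin_neg, Real.sin_pi_div_two, Real.cos_neg, Real.cos_pi_div_two] at h
  rw [mul_one, mul_neg, mul_one] at h
  rw [h]
  ring

/-- The volume of the parallel body of the lens in `ℝ³`, in coordinates. -/
theorem volume_parallel_lens {θ h r ρ : ℝ} (hh : 0 < h) (hr : 0 < r) (hr2 : r ^ 2 = 1 + h ^ 2)
    (hθ0 : 0 ≤ θ) (hθ : θ ≤ Real.pi / 2) (hs : r * Real.sin θ = 1) (hc : r * Real.cos θ = h)
    (hρ : 0 ≤ ρ)
    (hm : MeasurableSet {v : Euc 3 | |v 2| ≤ ρ ∧ NearLens h r √(ρ ^ 2 - v 2 ^ 2) (v 0) (v 1)}) :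
    volume.real {v : Euc 3 | |v 2| ≤ ρ ∧ NearLens h r √(ρ ^ 2 - v 2 ^ 2) (v 0) (v 1)} =
      2 * (2 * r ^ 2 * θ - 2 * h) * ρ + Real.pi / 2 * (4 * r * θ) * ρ ^ 2 +
        4 * Real.pi / 3 * ρ ^ 3 := by
  set T : Set (ℝ × (ℝ × ℝ)) := {q | |q.1| ≤ ρ ∧ NearLens h r √(ρ ^ 2 - q.1 ^ 2) q.2.1 q.2.2}
    with hT
  have hST : {v : Euc 3 | |v 2| ≤ ρ ∧ NearLens h r √(ρ ^ 2 - v 2 ^ 2) (v 0) (v 1)} =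
      lastFirst ⁻¹' T := rfl
  rw [hST] at hm ⊢
  have hTm : MeasurableSet T := (MeasurableEquiv.measurableSet_preimage lastFirst).mp hm
  rw [measureReal_def, measurePreserving_lastFirst.measure_preimage_equiv, Measure.volume_eq_prod,
    Measure.prod_apply hTm]
  set g : ℝ → ℝ := fun z => 2 * r ^ 2 * θ - 2 * h + 4 * r * θ * √(ρ ^ 2 - z ^ 2) +
    Real.pi * √(ρ ^ 2 - z ^ 2) ^ 2 with hg
  have h1 : ∀ z, volume (Prod.mk z ⁻¹' T) =
      (Set.Icc (-ρ) ρ).indicator (fun z => ENNReal.ofReal (g z)) z := by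
    intro z
    by_cases hz : |z| ≤ ρ
    · rw [Set.indicator_of_mem (Set.mem_Icc.mpr (abs_le.mp hz)), hg,
        ← volume_nearLens hh hr hr2 hθ0 hθ hs hc (Real.sqrt_nonneg _)]
      congr 1
      ext p
      simp [hT, hz]
    · rw [Set.indicator_of_notMem (s := Set.Icc (-ρ) ρ) (fun h => hz (abs_le.mpr h))]
      simp [hT, hz]
  have hgc : Continuous g := by fun_prop
  simp only [h1]
  rw [lintegral_indicator measurableSet_Icc, ← ofReal_integral_eq_lintegral_ofReal
    hgc.integrableOn_Icc (Filter.Eventually.of_forall fun z =>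
      planar_steiner_nonneg hh hr hr2 hθ0 hθ hs hc (Real.sqrt_nonneg _)),
    ENNReal.toReal_ofReal (integral_nonneg fun z =>
      planar_steiner_nonneg hh hr hr2 hθ0 hθ hs hc (Real.sqrt_nonneg _)),
    integral_Icc_eq_integral_Ioc, ← intervalIntegral.integral_of_le (by linarith)]
  have h2 : ∀ z ∈ Set.uIcc (-ρ) ρ, g z = 2 * r ^ 2 * θ - 2 * h +
      4 * r * θ * √(ρ ^ 2 - z ^ 2) + Real.pi * (ρ ^ 2 - z ^ 2) := by
    intro z hz
    rw [Set.uIcc_of_le (by linarith)] at hz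
    have : z ^ 2 ≤ ρ ^ 2 := sq_le_sq' hz.1 hz.2
    simp only [hg]
    rw [Real.sq_sqrt (by linarith)]
  have hi : ∀ f : ℝ → ℝ, Continuous f → IntervalIntegrable f volume (-ρ) ρ :=
    fun f hf => hf.intervalIntegrable _ _
  have h3 : ∫ z in -ρ..ρ, (ρ ^ 2 - z ^ 2) = 4 / 3 * ρ ^ 3 := by
    rw [intervalIntegral.integral_sub (hi _ (by fun_prop)) (hi _ (by fun_prop)),
      intervalIntegral.integral_const, integral_pow, smul_eq_mul]
    norm_num
    ring
  rw [intervalIntegral.integral_congr h2,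
    intervalIntegral.integral_add (hi _ (by fun_prop)) (hi _ (by fun_prop)),
    intervalIntegral.integral_add (hi _ (by fun_prop)) (hi _ (by fun_prop)),
    intervalIntegral.integral_const_mul, intervalIntegral.integral_const_mul,
    integral_sqrt_sq_sub_sq_full hρ, h3, intervalIntegral.integral_const, smul_eq_mul]
  ring

/-! ### Hausdorff length of circular arcs -/

section ArcLength

theorem lipschitzWith_of_dist_eq_sin {X : Type*} [MetricSpace X] {γ : ℝ → X} {r : ℝ} (hr : 0 ≤ r)
    (hγ : ∀ s t, dist (γ s) (γ t) = 2 * r * |Real.sin ((s - t) / 2)|) :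
    LipschitzWith r.toNNReal γ := by
  refine LipschitzWith.of_dist_le_mul fun s t => ?_
  rw [hγ, Real.coe_toNNReal _ hr, Real.dist_eq]
  have h : |Real.sin ((s - t) / 2)| ≤ |(s - t) / 2| := Real.abs_sin_le_abs
  rw [abs_div, abs_two] at h
  nlinarith

variable {X : Type*} [MetricSpace X] [MeasurableSpace X] [BorelSpace X]

/-- A continuous path is at least as long as its chord. -/
theorem ofReal_dist_le_hausdorffMeasure_image {γ : ℝ → X} (hγ : Continuous γ) {a b : ℝ}
    (hab : a ≤ b) :
    ENNReal.ofReal (dist (γ b) (γ a)) ≤ Measure.hausdorffMeasure 1 (γ '' Set.Icc a b) := by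
  -- The distance to `γ a` is a 1-Lipschitz function, and on the path it takes every value between
  -- `0` and the chord length.
  have h1 : Set.Icc 0 (dist (γ b) (γ a)) ⊆ (fun x => dist x (γ a)) '' (γ '' Set.Icc a b) := by
    have := intermediate_value_Icc hab (f := fun t => dist (γ t) (γ a)) (by fun_prop)
    rw [dist_self] at this
    rwa [Set.image_image]
  have h2 := (LipschitzWith.dist_left (γ a)).hausdorffMeasure_image_le zero_le_one
    (γ '' Set.Icc a b)
  calc ENNReal.ofReal (dist (γ b) (γ a)) = volume (Set.Icc 0 (dist (γ b) (γ a))) := by simp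
    _ = Measure.hausdorffMeasure 1 (Set.Icc 0 (dist (γ b) (γ a))) := by
      rw [hausdorffMeasure_real]
    _ ≤ _ := measure_mono h1
    _ ≤ _ := by simpa using h2

variable {γ : ℝ → X} {r : ℝ}

theorem hausdorffMeasure_arc_le (hr : 0 ≤ r)
    (hγ : ∀ s t, dist (γ s) (γ t) = 2 * r * |Real.sin ((s - t) / 2)|) (a b : ℝ) :
    Measure.hausdorffMeasure 1 (γ '' Set.Icc a b) ≤ ENNReal.ofReal (r * (b - a)) := by
  refine ((lipschitzWith_of_dist_eq_sin hr hγ).hausdorffMeasure_image_le zero_le_one _).trans ?_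
  rw [hausdorffMeasure_real, Real.volume_Icc, ENNReal.rpow_one, ENNReal.ofReal_mul hr]
  rfl

/-- The two pieces share only `γ b`: a common point has chord zero, and the half-angle, being less
than `π`, must then vanish. -/
theorem hausdorffMeasure_real_arc_add (hr : 0 < r)
    (hγ : ∀ s t, dist (γ s) (γ t) = 2 * r * |Real.sin ((s - t) / 2)|) {a b c : ℝ} (hab : a ≤ b)
    (hbc : b ≤ c) (hac : c - a ≤ Real.pi) :
    (Measure.hausdorffMeasure 1 (γ '' Set.Icc a c)).toReal =
      (Measure.hausdorffMeasure 1 (γ '' Set.Icc a b)).toReal +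
        (Measure.hausdorffMeasure 1 (γ '' Set.Icc b c)).toReal := by
  have hcont : Continuous γ := (lipschitzWith_of_dist_eq_sin hr.le hγ).continuous
  have hfin : ∀ a b, Measure.hausdorffMeasure 1 (γ '' Set.Icc a b) ≠ ⊤ := fun a b =>
    ((hausdorffMeasure_arc_le hr.le hγ a b).trans_lt ENNReal.ofReal_lt_top).ne
  have := Measure.nullSingletonClass_hausdorff X one_pos
  have hinter : Measure.hausdorffMeasure 1 (γ '' Set.Icc a b ∩ γ '' Set.Icc b c) = 0 := by
    refine measure_mono_null (t := {γ b}) ?_ (measure_singleton _)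
    rintro _ ⟨⟨s, hs, rfl⟩, ⟨t, ht, hst⟩⟩
    have h0 := hγ t s
    rw [hst, dist_self] at h0
    have h1 : Real.sin ((t - s) / 2) = 0 := by
      have : |Real.sin ((t - s) / 2)| = 0 := by
        rcases mul_eq_zero.mp h0.symm with h | h
        · linarith
        · exact h
      exact abs_eq_zero.mp this
    have h2 : (t - s) / 2 = 0 := by
      by_contra hne
      have hpos : 0 < (t - s) / 2 := lt_of_le_of_ne (by linarith [hs.2, ht.1]) (Ne.symm hne)
      have := Real.sin_pos_of_pos_of_lt_pi hpos (by linarith [hs.1, ht.2, Real.pi_pos])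
      linarith
    have h3 : s = b := by linarith [hs.2, ht.1]
    rw [h3]; rfl
  have h := measure_union_add_inter (μ := Measure.hausdorffMeasure 1) (γ '' Set.Icc a b)
    (isCompact_Icc.image hcont).isClosed.measurableSet (t := γ '' Set.Icc b c)
  rw [hinter, add_zero, ← Set.image_union, Set.Icc_union_Icc_eq_Icc hab hbc] at h
  rw [h, ENNReal.toReal_add (hfin _ _) (hfin _ _)]

/-- The length of a circular arc of radius `r` parametrized by the angle. -/
theorem hausdorffMeasure_real_arc (hr : 0 < r)
    (hγ : ∀ s t, dist (γ s) (γ t) = 2 * r * |Real.sin ((s - t) / 2)|) {a b : ℝ} (hab : a ≤ b)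
    (hba : b - a ≤ Real.pi) :
    (Measure.hausdorffMeasure 1 (γ '' Set.Icc a b)).toReal = r * (b - a) := by
  have hcont : Continuous γ := (lipschitzWith_of_dist_eq_sin hr.le hγ).continuous
  have hfin : ∀ a b, Measure.hausdorffMeasure 1 (γ '' Set.Icc a b) ≠ ⊤ := fun a b =>
    ((hausdorffMeasure_arc_le hr.le hγ a b).trans_lt ENNReal.ofReal_lt_top).ne
  apply le_antisymm
  · exact ENNReal.toReal_le_of_le_ofReal (by nlinarith) (hausdorffMeasure_arc_le hr.le hγ a b)
  -- Lower bound by an inscribed polygon with `n` chords, each spanning the angle `δ`.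
  have hstep : ∀ (δ : ℝ), 0 ≤ δ → ∀ n : ℕ, n * δ ≤ Real.pi →
      n * (2 * r * Real.sin (δ / 2)) ≤
        (Measure.hausdorffMeasure 1 (γ '' Set.Icc a (a + n * δ))).toReal := by
    intro δ hδ n
    induction n with
    | zero => intro _; simp
    | succ k ih =>
      intro hk
      push_cast at hk ⊢
      rw [hausdorffMeasure_real_arc_add hr hγ (b := a + k * δ) (by nlinarith) (by nlinarith)
        (by linarith)]
      have h1 := ih (by nlinarith)
      have h2 := ofReal_dist_le_hausdorffMeasure_image hcont
        (show a + k * δ ≤ a + (k + 1) * δ by nlinarith)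
      rw [ENNReal.ofReal_le_iff_le_toReal (hfin _ _), hγ] at h2
      rw [show (a + (k + 1) * δ - (a + k * δ)) / 2 = δ / 2 by ring] at h2
      have h3 := le_abs_self (Real.sin (δ / 2))
      nlinarith
  -- For `δ = (b - a)/n` the polygon has length `r (b - a) sinc((b - a)/(2n))`.
  have hlim : Filter.Tendsto (fun n : ℕ => r * (b - a) * Real.sinc ((b - a) / 2 / (n : ℝ)))
      Filter.atTop (nhds (r * (b - a))) := by
    have h0 : Filter.Tendsto (fun n : ℕ => (b - a) / 2 / (n : ℝ)) Filter.atTop (nhds 0) :=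
      tendsto_const_div_atTop_nhds_zero_nat _
    have h1 := (Real.continuous_sinc.tendsto 0).comp h0
    rw [Real.sinc_zero] at h1
    simpa using h1.const_mul (r * (b - a))
  refine le_of_tendsto hlim (Filter.eventually_atTop.mpr ⟨1, fun n hn => ?_⟩)
  have hn0 : (0 : ℝ) < n := by exact_mod_cast hn
  have h := hstep ((b - a) / n) (by apply div_nonneg <;> linarith) n
    (by rw [mul_div_cancel₀ _ hn0.ne']; exact hba)
  rw [mul_div_cancel₀ _ hn0.ne', add_sub_cancel] at h
  refine le_trans (le_of_eq ?_) h
  rcases hab.eq_or_lt with hab' | hab'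
  · simp [hab']
  · have hne : (b - a) / 2 / (n : ℝ) ≠ 0 := by
      have : 0 < b - a := by linarith
      positivity
    rw [Real.sinc_of_ne_zero hne, show (b - a) / (n : ℝ) / 2 = (b - a) / 2 / n by ring]
    have : b - a ≠ 0 := by linarith
    field_simp

end ArcLength

/-! ### The lens as a convex body, its boundary and perimeter -/

theorem euc3_dist_le_iff {x y : Euc 3} {r : ℝ} (hr : 0 ≤ r) :
    dist x y ≤ r ↔ (x 0 - y 0) ^ 2 + (x 1 - y 1) ^ 2 + (x 2 - y 2) ^ 2 ≤ r ^ 2 := by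
  rw [EuclideanSpace.dist_eq, Real.sqrt_le_left hr, Fin.sum_univ_three]
  simp only [Real.dist_eq, sq_abs]

theorem euc3_dist_lt_iff {x y : Euc 3} {r : ℝ} (hr : 0 < r) :
    dist x y < r ↔ (x 0 - y 0) ^ 2 + (x 1 - y 1) ^ 2 + (x 2 - y 2) ^ 2 < r ^ 2 := by
  rw [EuclideanSpace.dist_eq, Real.sqrt_lt' hr, Fin.sum_univ_three]
  simp only [Real.dist_eq, sq_abs]

/-- The symmetric lens in the plane `x₃ = 0` that is cut out by the discs of radius `r` about
`(0, ±h, 0)`. -/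
def lensBody (h r : ℝ) (hhr : |h| ≤ r) : ConvexBody (Euc 3) where
  carrier := {x | x 2 = 0 ∧ dist x !₂[0, -h, 0] ≤ r ∧ dist x !₂[0, h, 0] ≤ r}
  convex' := by
    have h1 : Convex ℝ {x : Euc 3 | x 2 = 0} := by
      intro x hx y hy a b _ _ _
      simp only [Set.mem_ofPred_eq] at hx hy
      simp [hx, hy]
    exact h1.inter ((convex_closedBall _ r).inter (convex_closedBall _ r))
  isCompact' := by
    refine (isCompact_closedBall (!₂[0, h, 0] : Euc 3) r).of_isClosed_subset ?_ fun x hx => hx.2.2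
    have h1 : IsClosed {x : Euc 3 | x 2 = 0} := isClosed_eq (by fun_prop) (by fun_prop)
    exact h1.inter (Metric.isClosed_closedBall.inter Metric.isClosed_closedBall)
  nonempty' := by
    have hr : 0 ≤ r := (abs_nonneg h).trans hhr
    have : h ^ 2 ≤ r ^ 2 := sq_le_sq' (by linarith [neg_abs_le h]) (by linarith [le_abs_self h])
    refine ⟨0, by simp, ?_, ?_⟩ <;> rw [euc3_dist_le_iff hr] <;> simpa using this

theorem mem_lensBody {h r : ℝ} {hhr : |h| ≤ r} {x : Euc 3} :
    x ∈ lensBody h r hhr ↔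
      x 2 = 0 ∧ x 0 ^ 2 + (x 1 + h) ^ 2 ≤ r ^ 2 ∧ x 0 ^ 2 + (x 1 - h) ^ 2 ≤ r ^ 2 := by
  have hr : 0 ≤ r := (abs_nonneg h).trans hhr
  change (x 2 = 0 ∧ dist x !₂[0, -h, 0] ≤ r ∧ dist x !₂[0, h, 0] ≤ r) ↔ _
  rw [euc3_dist_le_iff hr, euc3_dist_le_iff hr]
  constructor
  · rintro ⟨h1, h2, h3⟩
    simp [h1] at h2 h3
    exact ⟨h1, h2, h3⟩
  · rintro ⟨h1, h2, h3⟩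
    simp [h1]
    exact ⟨h2, h3⟩

theorem isSymmetricLens_lensBody {h r : ℝ} (hh : 0 < h) (hr : h < r) (hhr : |h| ≤ r) :
    IsSymmetricLens (lensBody h r hhr) := by
  refine ⟨!₂[0, -h, 0], !₂[0, h, 0], r, by simp, by simp, ?_, ?_, rfl⟩
  · refine dist_pos.mpr fun hc => ?_
    have := congrArg (fun v : Euc 3 => v 1) hc
    simp at this
    linarith
  · rw [euc3_dist_lt_iff (by linarith)]
    simp
    nlinarith

/-- The relative boundary of the lens consists of two circular arcs. -/
theorem intrinsicFrontier_lensBody {h r : ℝ} (hh : 0 < h) (hr2 : r ^ 2 = 1 + h ^ 2)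
    (hhr : |h| ≤ r) :
    intrinsicFrontier ℝ (lensBody h r hhr : Set (Euc 3)) =
      {x | x 2 = 0 ∧ x 0 ^ 2 + (x 1 + h) ^ 2 = r ^ 2 ∧ 0 ≤ x 1} ∪
      {x | x 2 = 0 ∧ x 0 ^ 2 + (x 1 - h) ^ 2 = r ^ 2 ∧ x 1 ≤ 0} := by
  set L := lensBody h r hhr
  have hplane : ∀ w ∈ affineSpan ℝ (L : Set (Euc 3)), w 2 = 0 := by
    have : affineSpan ℝ (L : Set (Euc 3)) ≤
        (LinearMap.ker (EuclideanSpace.proj (𝕜 := ℝ) (2 : Fin 3)).toLinearMap :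
          Submodule ℝ (Euc 3)).toAffineSubspace := by
      refine affineSpan_le.mpr fun x hx => ?_
      have := (mem_lensBody.mp hx).1
      simpa using this
    intro w hw
    simpa using this hw
  ext x
  rw [mem_intrinsicFrontier]
  constructor
  · rintro ⟨y, hy, rfl⟩
    have hyL : (y : Euc 3) ∈ L := (L.isClosed.preimage continuous_subtype_val).frontier_subset hy
    obtain ⟨h1, h2, h3⟩ := mem_lensBody.mp hyL
    by_contra hc
    simp only [Set.mem_union, Set.mem_ofPred_eq, not_or, not_and, not_le] at hc
    have h4 : (y : Euc 3) 0 ^ 2 + ((y : Euc 3) 1 + h) ^ 2 < r ^ 2 := by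
      refine lt_of_le_of_ne h2 fun he => ?_
      have := hc.1 h1 he
      nlinarith
    have h5 : (y : Euc 3) 0 ^ 2 + ((y : Euc 3) 1 - h) ^ 2 < r ^ 2 := by
      refine lt_of_le_of_ne h3 fun he => ?_
      have := hc.2 h1 he
      nlinarith
    refine hy.2 ?_
    rw [mem_interior]
    have hU : IsOpen {w : affineSpan ℝ (L : Set (Euc 3)) |
        (w : Euc 3) 0 ^ 2 + ((w : Euc 3) 1 + h) ^ 2 < r ^ 2 ∧
        (w : Euc 3) 0 ^ 2 + ((w : Euc 3) 1 - h) ^ 2 < r ^ 2} := by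
      simp only [Set.ofPred_and]
      exact (isOpen_lt (by fun_prop) (by fun_prop)).inter (isOpen_lt (by fun_prop) (by fun_prop))
    exact ⟨_, fun w hw => mem_lensBody.mpr ⟨hplane w w.2, hw.1.le, hw.2.le⟩, hU, h4, h5⟩
  · intro hx
    have h0L : (0 : Euc 3) ∈ L := mem_lensBody.mpr (by simp; linarith)
    have hxL : x ∈ L := by
      rw [mem_lensBody]
      rcases hx with ⟨h1, h2, h3⟩ | ⟨h1, h2, h3⟩
      · exact ⟨h1, h2.le, by nlinarith⟩
      · exact ⟨h1, by nlinarith, h2.le⟩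
    -- Points `(1 + ε) x` stay in the affine span, which contains `0` and `x`, but leave the lens
    -- for every `ε > 0`. So `x` is not a relative interior point.
    have hmem : ∀ ε : ℝ, AffineMap.lineMap (0 : Euc 3) x (1 + ε) ∈
        affineSpan ℝ (L : Set (Euc 3)) := fun ε =>
      AffineMap.lineMap_mem _ (subset_affineSpan ℝ _ h0L) (subset_affineSpan ℝ _ hxL)
    refine ⟨⟨x, subset_affineSpan ℝ _ hxL⟩, ⟨subset_closure hxL, fun hint => ?_⟩, rfl⟩
    set c : ℝ → affineSpan ℝ (L : Set (Euc 3)) := fun ε => ⟨_, hmem ε⟩ with hc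
    have hcc : Continuous c := by
      refine Continuous.subtype_mk ?_ _
      exact AffineMap.lineMap_continuous.comp (by fun_prop)
    have hc0 : c 0 = ⟨x, subset_affineSpan ℝ _ hxL⟩ := by simp [hc]
    have hev : ∀ᶠ ε in nhds (0 : ℝ), (c ε : Euc 3) ∈ L := by
      have := hcc.tendsto 0
      rw [hc0] at this
      exact this (mem_interior_iff_mem_nhds.mp hint)
    obtain ⟨ε, hεL, hε⟩ := ((hev.filter_mono nhdsWithin_le_nhds).and
      (self_mem_nhdsWithin : Set.Ioi (0 : ℝ) ∈ nhdsWithin 0 (Set.Ioi 0))).exists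
    have hval : ∀ i, (c ε : Euc 3) i = (1 + ε) * x i := by
      intro i
      simp [hc, AffineMap.lineMap_apply]
    obtain ⟨-, h6, h7⟩ := mem_lensBody.mp hεL
    rw [hval, hval] at h6 h7
    have hpos : 0 ≤ x 0 ^ 2 + x 1 ^ 2 := by positivity
    rcases hx with ⟨h1, h2, h3⟩ | ⟨h1, h2, h3⟩
    · have h8 : x 0 ^ 2 + x 1 ^ 2 + 2 * h * x 1 = 1 := by linarith
      have h9 : (1 + ε) * ((1 + ε) * (x 0 ^ 2 + x 1 ^ 2) + 2 * h * x 1) ≤ 1 := by linarith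
      rw [show (1 + ε) * (x 0 ^ 2 + x 1 ^ 2) + 2 * h * x 1 = 1 + ε * (x 0 ^ 2 + x 1 ^ 2) by
        linarith] at h9
      nlinarith [mul_nonneg hε.le hpos, mul_nonneg hε.le (mul_nonneg hε.le hpos)]
    · have h8 : x 0 ^ 2 + x 1 ^ 2 - 2 * h * x 1 = 1 := by linarith
      have h9 : (1 + ε) * ((1 + ε) * (x 0 ^ 2 + x 1 ^ 2) - 2 * h * x 1) ≤ 1 := by linarith
      rw [show (1 + ε) * (x 0 ^ 2 + x 1 ^ 2) - 2 * h * x 1 = 1 + ε * (x 0 ^ 2 + x 1 ^ 2) by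
        linarith] at h9
      nlinarith [mul_nonneg hε.le hpos, mul_nonneg hε.le (mul_nonneg hε.le hpos)]

/-- An arc of the boundary of the lens, parametrized by the angle. -/
def lensArc (h r σ φ : ℝ) : Euc 3 := !₂[r * Real.sin φ, σ * (r * Real.cos φ - h), 0]

theorem dist_lensArc {h r σ : ℝ} (hr : 0 ≤ r) (hσ : σ ^ 2 = 1) (s t : ℝ) :
    dist (lensArc h r σ s) (lensArc h r σ t) = 2 * r * |Real.sin ((s - t) / 2)| := by
  rw [EuclideanSpace.dist_eq, Fin.sum_univ_three]
  simp only [Real.dist_eq, sq_abs, lensArc]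
  rw [← Real.sqrt_sq (show 0 ≤ 2 * r * |Real.sin ((s - t) / 2)| by positivity)]
  congr 1
  rw [mul_pow, sq_abs, Real.sin_sq_eq_half_sub, show 2 * ((s - t) / 2) = s - t by ring,
    Real.cos_sub]
  simp
  linear_combination r ^ 2 * (Real.cos s - Real.cos t) ^ 2 * hσ +
    r ^ 2 * Real.sin_sq_add_cos_sq s + r ^ 2 * Real.sin_sq_add_cos_sq t

/-- The sign `σ` selects the upper or lower arc. Since `h = r cos θ`, the condition `0 ≤ σ x₁` means
`cos θ ≤ cos φ`, that is `|φ| ≤ θ`; the angle is recovered by `arcsin`. -/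
theorem lensArc_image {θ h r σ : ℝ} (hr : 0 < r)
    (hθ0 : 0 ≤ θ) (hθ : θ ≤ Real.pi / 2) (hc : r * Real.cos θ = h)
    (hσ : σ ^ 2 = 1) :
    lensArc h r σ '' Set.Icc (-θ) θ =
      {x | x 2 = 0 ∧ x 0 ^ 2 + (x 1 + σ * h) ^ 2 = r ^ 2 ∧ 0 ≤ σ * x 1} := by
  have hh : 0 ≤ h := hc ▸ mul_nonneg hr.le
    (Real.cos_nonneg_of_neg_pi_div_two_le_of_le (by linarith [Real.pi_pos]) hθ)
  have hpi := Real.pi_pos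
  ext x
  constructor
  · rintro ⟨φ, hφ, rfl⟩
    have hcos : Real.cos θ ≤ Real.cos φ := by
      rw [← Real.cos_abs φ]
      exact Real.cos_le_cos_of_nonneg_of_le_pi (abs_nonneg _) (by linarith) (abs_le.mpr hφ)
    refine ⟨by simp [lensArc], ?_, ?_⟩
    · simp only [lensArc]
      simp
      linear_combination r ^ 2 * Real.sin_sq_add_cos_sq φ + r ^ 2 * Real.cos φ ^ 2 * hσ
    · simp only [lensArc]
      simp
      rw [← mul_assoc, ← sq, hσ]
      nlinarith
  · rintro ⟨h1, h2, h3⟩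
    have h2' : x 0 ^ 2 + (σ * x 1 + h) ^ 2 = r ^ 2 := by
      linear_combination h2 + (x 1 ^ 2 - h ^ 2) * hσ
    have hx0 : |x 0| ≤ r := abs_le_of_sq_le_sq (by nlinarith [sq_nonneg (σ * x 1 + h)]) hr.le
    have hx0' := abs_le.mp hx0
    set φ := Real.arcsin (x 0 / r) with hφ
    have hsin : r * Real.sin φ = x 0 := by
      rw [hφ, Real.sin_arcsin (by rw [le_div_iff₀ hr]; linarith)
        (by rw [div_le_iff₀ hr]; linarith)]
      field_simp
    have hcosn : 0 ≤ Real.cos φ := Real.cos_arcsin_nonneg _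
    have hcos : r * Real.cos φ = σ * x 1 + h := by
      rw [← sq_eq_sq₀ (by positivity) (by linarith)]
      rw [← hsin] at h2'
      linear_combination r ^ 2 * Real.sin_sq_add_cos_sq φ - h2'
    refine ⟨φ, abs_le.mp ?_, ?_⟩
    · by_contra hlt
      push Not at hlt
      have h5 : |φ| ≤ Real.pi / 2 :=
        abs_le.mpr ⟨Real.neg_pi_div_two_le_arcsin _, Real.arcsin_le_pi_div_two _⟩
      have := Real.cos_lt_cos_of_nonneg_of_le_pi hθ0 (by linarith) hlt
      rw [Real.cos_abs] at this
      nlinarith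
    · ext i
      fin_cases i
      · simpa [lensArc] using hsin
      · simp [lensArc, hcos, ← mul_assoc, ← sq, hσ]
      · simpa [lensArc] using h1.symm

theorem perimeter_lensBody {θ h r : ℝ} (hh : 0 < h) (hr : 0 < r) (hr2 : r ^ 2 = 1 + h ^ 2)
    (hθ0 : 0 ≤ θ) (hθ : θ ≤ Real.pi / 2) (hc : r * Real.cos θ = h)
    (hhr : |h| ≤ r) :
    perimeter (lensBody h r hhr) = 4 * r * θ := by
  have e1 : intrinsicFrontier ℝ (lensBody h r hhr : Set (Euc 3)) =
      lensArc h r 1 '' Set.Icc (-θ) θ ∪ lensArc h r (-1) '' Set.Icc (-θ) θ := by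
    rw [intrinsicFrontier_lensBody hh hr2, lensArc_image hr hθ0 hθ hc (by norm_num),
      lensArc_image hr hθ0 hθ hc (by norm_num)]
    simp [sub_eq_add_neg]
  have hd : ∀ σ : ℝ, σ ^ 2 = 1 → ∀ s t, dist (lensArc h r σ s) (lensArc h r σ t) =
      2 * r * |Real.sin ((s - t) / 2)| := fun σ hσ => dist_lensArc hr.le hσ
  have hlen : ∀ σ : ℝ, σ ^ 2 = 1 →
      (Measure.hausdorffMeasure 1 (lensArc h r σ '' Set.Icc (-θ) θ)).toReal = 2 * r * θ := by
    intro σ hσ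
    rw [hausdorffMeasure_real_arc hr (hd σ hσ) (by linarith) (by linarith)]
    ring
  have hfin : ∀ σ : ℝ, σ ^ 2 = 1 →
      Measure.hausdorffMeasure 1 (lensArc h r σ '' Set.Icc (-θ) θ) ≠ ⊤ := fun σ hσ =>
    ((hausdorffMeasure_arc_le hr.le (hd σ hσ) _ _).trans_lt ENNReal.ofReal_lt_top).ne
  have := Measure.nullSingletonClass_hausdorff (Euc 3) one_pos
  have hinter : Measure.hausdorffMeasure 1
      (lensArc h r 1 '' Set.Icc (-θ) θ ∩ lensArc h r (-1) '' Set.Icc (-θ) θ) = 0 := by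
    refine measure_mono_null (t := {!₂[1, 0, 0], !₂[-1, 0, 0]}) ?_
      (Set.Finite.measure_zero (by simp) _)
    rw [lensArc_image hr hθ0 hθ hc (by norm_num), lensArc_image hr hθ0 hθ hc (by norm_num)]
    rintro x ⟨⟨h1, h2, h3⟩, ⟨-, -, h4⟩⟩
    have h5 : x 1 = 0 := by linarith
    have h6 : x 0 ^ 2 = 1 := by rw [h5] at h2; linarith
    rcases sq_eq_one_iff.mp h6 with h7 | h7
    · left
      ext i
      fin_cases i <;> simp [h1, h5, h7]
    · right
      ext i
      fin_cases i <;> simp [h1, h5, h7]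
  have hm : MeasurableSet (lensArc h r (-1) '' Set.Icc (-θ) θ) :=
    (isCompact_Icc.image
      (lipschitzWith_of_dist_eq_sin hr.le (hd (-1) (by norm_num))).continuous).isClosed.measurableSet
  have h := measure_union_add_inter (μ := Measure.hausdorffMeasure 1)
    (lensArc h r 1 '' Set.Icc (-θ) θ) hm
  rw [hinter, add_zero] at h
  rw [perimeter, e1, h, ENNReal.toReal_add (hfin _ (by norm_num)) (hfin _ (by norm_num)),
    hlen _ (by norm_num), hlen _ (by norm_num)]
  ring

/-! ### Steiner formula and circumradius of the parallel bodies -/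

theorem coe_smul_unitBall {n : ℕ} {ρ : ℝ} (hρ : 0 ≤ ρ) :
    ρ • (unitBall n : Set (Euc n)) = Metric.closedBall 0 ρ := by
  change ρ • Metric.closedBall (0 : Euc n) 1 = _
  rw [smul_unitClosedBall, Real.norm_of_nonneg hρ]

theorem mem_add_smul_unitBall {n : ℕ} {L : ConvexBody (Euc n)} {ρ : ℝ} (hρ : 0 ≤ ρ) {v : Euc n} :
    v ∈ (L : Set (Euc n)) + ρ • (unitBall n : Set (Euc n)) ↔ ∃ q ∈ L, dist v q ≤ ρ := by
  rw [coe_smul_unitBall hρ, Set.mem_add]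
  constructor
  · rintro ⟨q, hq, w, hw, rfl⟩
    exact ⟨q, hq, by simpa using hw⟩
  · rintro ⟨q, hq, hd⟩
    exact ⟨q, hq, v - q, by simpa [dist_eq_norm] using hd, by simp⟩

theorem lensBody_add_smul_unitBall {h r ρ : ℝ} {hhr : |h| ≤ r} (hρ : 0 ≤ ρ) :
    (lensBody h r hhr : Set (Euc 3)) + ρ • (unitBall 3 : Set (Euc 3)) =
      {v : Euc 3 | |v 2| ≤ ρ ∧ NearLens h r √(ρ ^ 2 - v 2 ^ 2) (v 0) (v 1)} := by
  ext v
  rw [mem_add_smul_unitBall hρ]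
  constructor
  · rintro ⟨q, hq, hd⟩
    obtain ⟨h1, h2, h3⟩ := mem_lensBody.mp hq
    rw [euc3_dist_le_iff hρ, h1, sub_zero] at hd
    have h4 : v 2 ^ 2 ≤ ρ ^ 2 := by nlinarith [sq_nonneg (v 0 - q 0), sq_nonneg (v 1 - q 1)]
    refine ⟨abs_le_of_sq_le_sq h4 hρ, q 0, q 1, h2, h3, ?_⟩
    rw [Real.sq_sqrt (by linarith)]
    linarith
  · rintro ⟨hv, a, b, h2, h3, hd⟩
    have h4 : v 2 ^ 2 ≤ ρ ^ 2 := sq_le_sq' (abs_le.mp hv).1 (abs_le.mp hv).2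
    rw [Real.sq_sqrt (by linarith)] at hd
    refine ⟨!₂[a, b, 0], mem_lensBody.mpr ⟨by simp, by simpa using h2, by simpa using h3⟩, ?_⟩
    rw [euc3_dist_le_iff hρ]
    simp
    linarith

theorem add_smul_unitBall_add {n : ℕ} (L : ConvexBody (Euc n)) {ν ρ : ℝ} (hν : 0 ≤ ν)
    (hρ : 0 ≤ ρ) :
    ((L + ν • unitBall n : ConvexBody (Euc n)) : Set (Euc n)) + ρ • (unitBall n : Set (Euc n)) =
      L + (ν + ρ) • (unitBall n : Set (Euc n)) := by
  rw [ConvexBody.coe_add, ConvexBody.coe_smul, add_assoc, (unitBall n).convex.add_smul hν hρ]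

/-- The Steiner formula of the parallel bodies of the lens. -/
theorem steinerFormula_lensBody_add {θ h r ν : ℝ} (hh : 0 < h) (hr : 0 < r)
    (hr2 : r ^ 2 = 1 + h ^ 2) (hθ0 : 0 ≤ θ) (hθ : θ ≤ Real.pi / 2) (hs : r * Real.sin θ = 1)
    (hc : r * Real.cos θ = h) (hhr : |h| ≤ r) (hν : 0 ≤ ν) {c₁ c₂ c₃ : ℝ}
    (hc₁ : c₁ = 2 * (2 * r ^ 2 * θ - 2 * h)) (hc₂ : c₂ = Real.pi / 2 * (4 * r * θ))
    (hc₃ : c₃ = 4 * Real.pi / 3) :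
    SteinerFormula (lensBody h r hhr + ν • unitBall 3) (unitBall 3)
      ![c₁ * ν + c₂ * ν ^ 2 + c₃ * ν ^ 3, (c₁ + 2 * c₂ * ν + 3 * c₃ * ν ^ 2) / 3,
        (c₂ + 3 * c₃ * ν) / 3, c₃] := by
  intro ρ hρ
  have hcomp : IsCompact ((lensBody h r hhr + (ν + ρ) • unitBall 3 : ConvexBody (Euc 3)) :
    Set (Euc 3)) := ConvexBody.isCompact _
  have hm := hcomp.isClosed.measurableSet
  rw [ConvexBody.coe_add, ConvexBody.coe_smul] at hm
  rw [add_smul_unitBall_add _ hν hρ]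
  rw [lensBody_add_smul_unitBall (add_nonneg hν hρ)] at hm ⊢
  -- The entries of the vector are the Taylor coefficients at `ν` of `c₁ x + c₂ x² + c₃ x³`, divided
  -- by the binomials `1, 3, 3, 1`.
  rw [volume_parallel_lens hh hr hr2 hθ0 hθ hs hc (add_nonneg hν hρ) hm, ← hc₁, ← hc₂, ← hc₃]
  simp [Fin.sum_univ_four, Nat.choose]
  ring

/-- A body that lies in a ball about the origin and contains two antipodal points of it has the
radius of the ball as its circumradius. -/
theorem circumradius_eq_of_antipodal {n : ℕ} {K : ConvexBody (Euc n)} {R : ℝ} (hR : 0 ≤ R)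
    (hK : (K : Set (Euc n)) ⊆ Metric.closedBall 0 R) {u : Euc n} (hu : ‖u‖ = R) (h1 : u ∈ K)
    (h2 : -u ∈ K) : circumradius K (unitBall n) = R := by
  refine IsLeast.csInf_eq ⟨⟨hR, 0, ?_⟩, ?_⟩
  · rwa [coe_smul_unitBall hR, zero_vadd]
  · rintro S ⟨hS, x, hx⟩
    rw [coe_smul_unitBall hS, Metric.vadd_closedBall] at hx
    have h3 : dist u (-u) ≤ 2 * S := by
      have h3 := hx h1
      have h4 := hx h2
      rw [Metric.mem_closedBall] at h3 h4
      linarith [dist_triangle_right u (-u) (x +ᵥ (0 : Euc n))]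
    rw [dist_eq_norm, sub_neg_eq_add, ← two_smul ℝ u, norm_smul, hu] at h3
    norm_num at h3
    exact h3

theorem circumradius_lensBody_add {h r ν : ℝ} (hr2 : r ^ 2 = 1 + h ^ 2)
    (hhr : |h| ≤ r) (hν : 0 ≤ ν) :
    circumradius (lensBody h r hhr + ν • unitBall 3) (unitBall 3) = 1 + ν := by
  have hnorm : ‖(!₂[1 + ν, 0, 0] : Euc 3)‖ = 1 + ν := by
    rw [EuclideanSpace.norm_eq, Fin.sum_univ_three]
    simp [Real.sqrt_sq (add_nonneg zero_le_one hν)]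
  have hmem : ∀ v : Euc 3, v ∈ lensBody h r hhr + ν • unitBall 3 ↔
      ∃ q ∈ lensBody h r hhr, dist v q ≤ ν := by
    intro v
    rw [← mem_add_smul_unitBall hν, ← ConvexBody.coe_smul, ← ConvexBody.coe_add]
    rfl
  refine circumradius_eq_of_antipodal (by linarith) ?_ hnorm ?_ ?_
  · intro v hv
    obtain ⟨q, hq, hd⟩ := (hmem v).mp hv
    obtain ⟨h1, h2, h3⟩ := mem_lensBody.mp hq
    have h4 : dist q 0 ≤ 1 := by
      rw [euc3_dist_le_iff zero_le_one]
      simp [h1]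
      nlinarith
    rw [Metric.mem_closedBall]
    linarith [dist_triangle v q 0]
  · refine (hmem _).mpr ⟨!₂[1, 0, 0], mem_lensBody.mpr (by simp [hr2]), ?_⟩
    rw [euc3_dist_le_iff hν]
    simp
  · refine (hmem _).mpr ⟨!₂[-1, 0, 0], mem_lensBody.mpr (by simp [hr2]), ?_⟩
    rw [euc3_dist_le_iff hν]
    simp

theorem interior_add_smul_unitBall_nonempty {n : ℕ} (L : ConvexBody (Euc n)) {ν : ℝ}
    (hν : 0 < ν) :
    (interior ((L + ν • unitBall n : ConvexBody (Euc n)) : Set (Euc n))).Nonempty := by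
  obtain ⟨q, hq⟩ := L.nonempty
  refine ⟨q, mem_interior.mpr ⟨Metric.ball q ν, fun v hv => ?_, Metric.isOpen_ball,
    Metric.mem_ball_self hν⟩⟩
  rw [ConvexBody.coe_add, ConvexBody.coe_smul, mem_add_smul_unitBall hν.le]
  exact ⟨q, hq, (Metric.mem_ball.mp hv).le⟩

/-! ### Choice of the lens and location of the roots -/

/-- A real quadratic with negative discriminant has its roots on the axis of symmetry. -/
theorem re_eq_of_quadratic_root {a b c : ℝ} (ha : 0 < a) (hd : b ^ 2 < 4 * a * c) {w : ℂ}
    (hw : c + b * w + a * w ^ 2 = 0) : w.re = -b / (2 * a) := by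
  have hre := congrArg Complex.re hw
  have him := congrArg Complex.im hw
  simp [sq] at hre him
  have h1 : w.im * (b + 2 * a * w.re) = 0 := by linarith
  rcases mul_eq_zero.mp h1 with h2 | h2
  · exfalso
    rw [h2] at hre
    nlinarith [sq_nonneg (2 * a * w.re + b)]
  · field_simp
    linarith

/-- The half-angle of the lens with circumradius `1` and perimeter `5.2`. -/
theorem exists_lens_angle :
    ∃ θ : ℝ, 1.21 ≤ θ ∧ θ < Real.pi / 2 ∧ 1.3 * Real.sin θ = θ := by
  have hpi := Real.pi_gt_d4
  have hpi' := Real.pi_lt_d4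
  -- Then `1.3 sin x - x` is nonnegative at `1.21`, since `1.3 * 0.934 > 1.21`, and negative at
  -- `π/2`.
  have h1 : 0.934 ≤ Real.sin 1.21 := by
    rw [← Real.cos_pi_div_two_sub]
    refine le_trans ?_ (Real.one_sub_sq_div_two_le_cos)
    nlinarith
  have h2 : (0 : ℝ) ∈ Set.Icc (1.3 * Real.sin (Real.pi / 2) - Real.pi / 2)
      (1.3 * Real.sin 1.21 - 1.21) := by
    rw [Real.sin_pi_div_two]
    constructor <;> linarith
  obtain ⟨θ, hθ, h0⟩ := intermediate_value_Icc' (f := fun x => 1.3 * Real.sin x - x)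
    (show (1.21 : ℝ) ≤ Real.pi / 2 by linarith) (by fun_prop) h2
  simp only at h0
  refine ⟨θ, hθ.1, lt_of_le_of_ne hθ.2 fun he => ?_, by linarith⟩
  rw [he, Real.sin_pi_div_two] at h0
  linarith

/-- The lens with circumradius `1` and perimeter `5.2` has large area. -/
theorem lens_area_bound {θ h r : ℝ} (hh : 0 < h) (hr : 0 < r) (hr2 : r ^ 2 = 1 + h ^ 2)
    (hθ : 1.21 ≤ θ) (hrθ : r * θ = 1.3) :
    1.9915 < 2 * r ^ 2 * θ - 2 * h := by
  -- `1.3 / 1.21 < 1.0744`. The area equals `2.6 r - 2 √(r² - 1)`, and on `1 ≤ r ≤ 1.0744` this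
  -- exceeds `1.9915`.
  have h1 : r ≤ 1.0744 := by
    by_contra hc
    push Not at hc
    nlinarith
  have h2 : 1 ≤ r := by nlinarith
  have h3 : 2 * r ^ 2 * θ = 2.6 * r := by linear_combination 2 * r * hrθ
  have h4 : h < (2.6 * r - 1.9915) / 2 := by
    apply lt_of_pow_lt_pow_left₀ 2 (by linarith)
    rw [show h ^ 2 = r ^ 2 - 1 by linarith]
    nlinarith
  linarith

theorem isRoot_steinerPolynomial_lensBody_add {h r ν c₁ c₂ c₃ : ℝ} {hhr : |h| ≤ r}
    (hS : SteinerFormula (lensBody h r hhr + ν • unitBall 3) (unitBall 3)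
      ![c₁ * ν + c₂ * ν ^ 2 + c₃ * ν ^ 3, (c₁ + 2 * c₂ * ν + 3 * c₃ * ν ^ 2) / 3,
        (c₂ + 3 * c₃ * ν) / 3, c₃]) {s : ℂ}
    (hs : (steinerPolynomial (lensBody h r hhr + ν • unitBall 3) (unitBall 3)).IsRoot s) :
    s + ν = 0 ∨ c₁ + c₂ * (s + ν) + c₃ * (s + ν) ^ 2 = 0 := by
  rw [← mul_eq_zero]
  rw [Polynomial.IsRoot, steinerPolynomial, hS.quermassintegral_eq] at hs
  simp [Fin.sum_univ_four, Nat.choose] at hs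
  rw [← hs]
  ring

/-- The parallel bodies of the lens violate the circumradius bound. -/
theorem neg_circumradius_lt_re {θ h r ν : ℝ} (hh : 0 < h) (hr : 0 < r)
    (hr2 : r ^ 2 = 1 + h ^ 2) (hθ1 : 1.21 ≤ θ) (hθ : θ ≤ Real.pi / 2) (hs : r * Real.sin θ = 1)
    (hc : r * Real.cos θ = h) (hrθ : r * θ = 1.3) (hhr : |h| ≤ r) (hν : 0 ≤ ν) {s : ℂ}
    (hroot : (steinerPolynomial (lensBody h r hhr + ν • unitBall 3) (unitBall 3)).IsRoot s) :
    -circumradius (lensBody h r hhr + ν • unitBall 3) (unitBall 3) < s.re := by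
  have hpi := Real.pi_pos
  have hpi' := Real.pi_lt_d4
  have hS := steinerFormula_lensBody_add hh hr hr2 (by linarith) hθ hs hc hhr hν rfl rfl rfl
  rw [circumradius_lensBody_add hr2 hhr hν]
  rcases isRoot_steinerPolynomial_lensBody_add hS hroot with h1 | h1
  · have := congrArg Complex.re h1
    simp at this
    linarith
  · have hA := lens_area_bound hh hr hr2 hθ1 hrθ
    have h2 := re_eq_of_quadratic_root (by positivity) ?_ h1
    · rw [mul_assoc 4 r θ, hrθ] at h2
      -- This is `-3p/16` with `p = 5.2`.
      have h3 : (s + ν).re = -0.975 := by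
        rw [h2]
        field_simp
        norm_num
      simp at h3
      linarith
    · rw [mul_assoc 4 r θ, hrθ]
      -- Negative discriminant means `A > 3π · 5.2² / 128`, about `1.99098`, just below the proved
      -- bound `1.9915`.
      nlinarith [mul_lt_mul_of_pos_left hA hpi, mul_pos hpi hpi]

end

/-- The `SteinerFormula` clause certifies that `quermassintegral`, a choice by `Classical.epsilon`,
really satisfies the Steiner formula for these bodies. The final negation uses `ν = 1` and `E =
B_3`. -/
theorem theorem1p4 :
    (∃ L : ConvexBody (Euc 3),
      IsSymmetricLens L ∧ circumradius L (unitBall 3) = 1 ∧ perimeter L = 5.2 ∧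
      ∀ ν : ℝ, 0 < ν → ∃ K : ConvexBody (Euc 3),
        K = L + ν • unitBall 3 ∧
        (interior (K : Set (Euc 3))).Nonempty ∧
        SteinerFormula K (unitBall 3) (quermassintegral K (unitBall 3)) ∧
        ∀ s : ℂ, (steinerPolynomial K (unitBall 3)).IsRoot s →
          -circumradius K (unitBall 3) < s.re) ∧
    ¬ ∀ K E : ConvexBody (Euc 3), (interior (K : Set (Euc 3))).Nonempty →
        (interior (E : Set (Euc 3))).Nonempty → CircumradiusBound K E := by
  obtain ⟨θ, hθ1, hθ, hθs⟩ := exists_lens_angle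
  have hsin : 0 < Real.sin θ := by linarith
  have hcos : 0 < Real.cos θ :=
    Real.cos_pos_of_mem_Ioo ⟨by linarith, hθ⟩
  obtain ⟨r, hr⟩ : ∃ r, r = 1 / Real.sin θ := ⟨_, rfl⟩
  obtain ⟨h, hh⟩ : ∃ h, h = r * Real.cos θ := ⟨_, rfl⟩
  have hr0 : 0 < r := hr ▸ by positivity
  have hh0 : 0 < h := hh ▸ by positivity
  have hs : r * Real.sin θ = 1 := by rw [hr]; field_simp
  have hr2 : r ^ 2 = 1 + h ^ 2 := by
    rw [hh]
    linear_combination (r * Real.sin θ + 1) * hs - r ^ 2 * Real.sin_sq_add_cos_sq θ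
  -- The equation `1.3 sin θ = θ` was chosen for this: with `r sin θ = 1` it makes the perimeter
  -- `4rθ` equal to `5.2`.
  have hrθ : r * θ = 1.3 := by linear_combination 1.3 * hs - r * hθs
  have hlt : h < r := by nlinarith
  have hhr : |h| ≤ r := by rw [abs_of_pos hh0]; exact hlt.le
  have hroots := fun (ν : ℝ) (hν : 0 ≤ ν) (s : ℂ) =>
    neg_circumradius_lt_re (s := s) hh0 hr0 hr2 hθ1 hθ.le hs hh.symm hrθ hhr hν
  refine ⟨⟨lensBody h r hhr, isSymmetricLens_lensBody hh0 hlt hhr, ?_, ?_, fun ν hν =>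
    ⟨_, rfl, interior_add_smul_unitBall_nonempty _ hν, ?_, hroots ν hν.le⟩⟩, fun H => ?_⟩
  · have := circumradius_lensBody_add hr2 hhr le_rfl
    have h0 : lensBody h r hhr + (0 : ℝ) • unitBall 3 = lensBody h r hhr := by
      apply SetLike.coe_injective
      rw [ConvexBody.coe_add, ConvexBody.coe_smul, coe_smul_unitBall le_rfl]
      simp
    rwa [h0, add_zero] at this
  · rw [perimeter_lensBody hh0 hr0 hr2 (by linarith) hθ.le hh.symm hhr, mul_assoc, hrθ]
    norm_num
  · have hS := steinerFormula_lensBody_add hh0 hr0 hr2 (by linarith) hθ.le hs hh.symm hhr hν.le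
      rfl rfl rfl
    rwa [hS.quermassintegral_eq]
  · obtain ⟨s, hs1, hs2⟩ := H (lensBody h r hhr + (1 : ℝ) • unitBall 3) (unitBall 3)
      (interior_add_smul_unitBall_nonempty _ one_pos)
      ⟨0, mem_interior.mpr ⟨Metric.ball 0 1, Metric.ball_subset_closedBall, Metric.isOpen_ball,
        Metric.mem_ball_self one_pos⟩⟩
    exact absurd (hroots 1 zero_le_one s hs1) (not_lt.mpr hs2)
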